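/- Let $n,k$ be natural numbers. The cake is $[0,1]$; each player $i\in\{1,\dots,n\}$ has a continuous density $d_i:[0,1]\to[0,\infty)$ with $\int_0^1 d_i=1$, and values a portion $S\subseteq[0,1]$ at $V_i(S)=\int_S d_i(x)\,dx$. Suppose the instance belongs to $X(k)$: there are points $0=t_0<t_1<\dots<t_{nk}=1$ and an assignment of the $nk$ consecutive pieces $[t_{r-1},t_r]$ to the players such that each player $i$ owns exactly $k$ of them, denoted $i_1,\dots,i_k$, and $V_l(i_m)=0$ for all $l\ne i$ and $1\le m\le k$. Then there is an envy-free contiguous allocation of the entire cake in which every player gets at least the value of his most valuable owned piece. That is, there are pairwise disjoint intervals $A_1,\dots,A_n$ with $A_1\cup\dots\cup A_n=[0,1]$ such that $$V_i(A_i)\ge V_i(A_j)\quad\text{for all } i,j,\qquad\text{and}\qquad V_i(A_i)\ge \max_{1\le m\le k}V_i(i_m)\quad\text{for all } i.$$ -/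

import Mathlib

open MeasureTheory Set

/-- A cake cutting instance with `n` players. The cake is the interval `[0,1]`, and every player `i`
has a continuous nonnegative value density on the cake whose total integral is `1`. -/
structure CakeInstance (n : ℕ) where
  density : Fin n → ℝ → ℝ
  continuousOn_density : ∀ i, ContinuousOn (density i) (Icc 0 1)
  density_nonneg : ∀ i, ∀ x ∈ Icc (0 : ℝ) 1, 0 ≤ density i x
  integral_density : ∀ i, ∫ x in Icc (0 : ℝ) 1, density i x = 1

namespace CakeInstance

/-- The value `V_i(S)` that player `i` assigns to a portion `S` of the cake. -/
noncomputable def value {n : ℕ} (I : CakeInstance n) (i : Fin n) (S : Set ℝ) : ℝ :=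
  ∫ x in S, I.density i x

/-- A witness that the instance `I` lies in `X(k)`: the cake is cut at
`0 = bdry 0 < bdry 1 < ⋯ < bdry (n * k) = 1` into `n * k` consecutive pieces, which are arranged
in an arbitrary order `pos`; the piece with label `(i, m)` is the `m`-th of the `k` pieces owned by
player `i`, and it is worth `0` to every other player. -/
structure OwnedPieces {n : ℕ} (I : CakeInstance n) (k : ℕ) where
  bdry : Fin (n * k + 1) → ℝ
  strictMono_bdry : StrictMono bdry
  bdry_zero : bdry 0 = 0
  bdry_last : bdry (Fin.last (n * k)) = 1
  pos : Fin n × Fin k ≃ Fin (n * k)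
  value_eq_zero : ∀ (i : Fin n) (m : Fin k) (l : Fin n), l ≠ i →
    I.value l (Icc (bdry (pos (i, m)).castSucc) (bdry (pos (i, m)).succ)) = 0

/-- The `m`-th piece owned by player `i`. -/
def OwnedPieces.piece {n : ℕ} {I : CakeInstance n} {k : ℕ} (P : I.OwnedPieces k)
    (i : Fin n) (m : Fin k) : Set ℝ :=
  Icc (P.bdry (P.pos (i, m)).castSucc) (P.bdry (P.pos (i, m)).succ)

/-- The value to player `i` of the most valuable piece that he owns
(a maximum over the `k` owned pieces). -/
noncomputable def OwnedPieces.maxPieceValue {n : ℕ} {I : CakeInstance n} {k : ℕ}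
    (P : I.OwnedPieces k) (i : Fin n) : ℝ :=
  ⨆ m : Fin k, I.value i (P.piece i m)

/-- The allocation `A` is envy-free: nobody prefers another player's portion to his own. -/
def EnvyFree {n : ℕ} (I : CakeInstance n) (A : Fin n → Set ℝ) : Prop :=
  ∀ i j, I.value i (A j) ≤ I.value i (A i)

end CakeInstance

/-- A contiguous allocation of the whole cake `[0,1]` to `n` players: the portions are intervals
(order-connected sets), they are mutually disjoint, and together they make up the cake. -/
structure IsContiguousAllocation {n : ℕ} (A : Fin n → Set ℝ) : Prop where
  ordConnected : ∀ i, (A i).OrdConnected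
  disjoint : ∀ i j, i ≠ j → Disjoint (A i) (A j)
  iUnion_eq : ⋃ i, A i = Icc (0 : ℝ) 1

/-! Let `[p i, q i]` be the most valuable piece owned by player `i`, of value `v` to him. Replace
his valuation by the boosted value `W_i(S) = V_i(S) + min (v - w) w`, where `w` is his value for the
part of `S` inside that piece. It depends continuously on the cuts and is nonpositive on a
degenerate interval, so the equilibrium theorem `exists_perm_forall_le` gives cuts that are
envy-free for `W`.

These cuts are then rounded (`exists_rounded_cuts`): an end of player `i`'s interval lying strictly
inside his piece moves outwards to the end of the piece. Only player `i` notices, since the piece is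
worthless to the others. His interval now has true value at least its former `W_i`, while the other
intervals have not grown in his eyes and were worth at most that; hence there is no envy. His piece
lay inside one interval, or contained a whole one, or was split by one cut. In the first case that
interval was already worth `v` to him; in the second the inner interval is his, being worthless to
anyone else, and rounding completes the piece; in the third the more valuable part has boosted value
at least `w + (v - w) = v`.

The equilibrium theorem is a limit of a Sperner lemma on the lattice `∑ i, a i = N`, proved by
parity: relabelling one lattice point preserves the number of fully labelled alcoves mod 2, and one
explicit labelling has exactly one. -/

/-! ### Parity of bijective relabellings -/

/-- If `L` is bijective, only the index already labelled `j` contributes. Otherwise a contribution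
forces `L` to miss exactly `j` and to repeat one label, and the two indices sharing that label are
the two contributors. -/
theorem card_bijective_update_mod_two {ι : Type*} [Fintype ι] [DecidableEq ι] (L : ι → ι) (j : ι)
    [DecidablePred fun f : ι → ι => Function.Bijective f] :
    ∑ k, (if Function.Bijective (Function.update L k j) then (1 : ZMod 2) else 0) =
      if Function.Bijective L then 1 else 0 := by
  have key : ∀ k, Function.Bijective (Function.update L k j) ↔
      ∀ x y, x ≠ k → (y ≠ k → L x = L y → x = y) ∧ L x ≠ j := by
    intro k
    rw [← Finite.injective_iff_bijective]
    constructor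
    · intro h x y hx
      refine ⟨fun hy hxy => h (by simp [hx, hy, hxy]), fun hj => hx (h (by simp [hx, hj]))⟩
    · intro h x y hxy
      by_cases hx : x = k <;> by_cases hy : y = k
      · rw [hx, hy]
      · subst hx
        simp only [Function.update_self, Function.update_of_ne hy] at hxy
        exact absurd hxy.symm (h y y hy).2
      · subst hy
        simp only [Function.update_self, Function.update_of_ne hx] at hxy
        exact absurd hxy (h x x hx).2
      · simp only [Function.update_of_ne hx, Function.update_of_ne hy] at hxy
        exact (h x y hx).1 hy hxy
  split_ifs with hL
  · obtain ⟨k, hk⟩ := hL.2 j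
    rw [Finset.sum_eq_single k]
    · rw [if_pos]
      rw [← hk, Function.update_eq_self]
      exact hL
    · intro l _ hl
      rw [if_neg]
      exact fun h => ((key l).1 h k k hl.symm).2 hk
    · simp
  · by_cases hex : ∃ k, Function.Bijective (Function.update L k j)
    · obtain ⟨k, hk⟩ := hex
      have hk' := (key k).1 hk
      have hne : L k ≠ j := by
        intro h
        rw [← h, Function.update_eq_self] at hk
        exact hL hk
      obtain ⟨l, hl⟩ := hk.2 (L k)
      have hlk : l ≠ k := by
        rintro rfl
        simp only [Function.update_self] at hl
        exact hne hl.symm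
      rw [Function.update_of_ne hlk] at hl
      have hl' : Function.Bijective (Function.update L l j) := by
        rw [key]
        intro x y hx
        refine ⟨fun hy hxy => ?_, ?_⟩
        · by_cases hxk : x = k
          · by_contra hne'
            subst hxk
            exact hy ((hk' y l (Ne.symm hne')).1 hlk (hxy.symm.trans hl.symm))
          · by_cases hyk : y = k
            · subst hyk
              exact absurd ((hk' x l hxk).1 hlk (hxy.trans hl.symm)) hx
            · exact (hk' x y hxk).1 hyk hxy
        · by_cases hxk : x = k
          · rwa [hxk]
          · exact (hk' x x hxk).2
      rw [← Finset.sum_subset (Finset.subset_univ {k, l}), Finset.sum_pair hlk.symm,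
        if_pos hk, if_pos hl']
      · decide
      · intro x _ hx
        rw [if_neg]
        intro h
        simp only [Finset.mem_insert, Finset.mem_singleton, not_or] at hx
        exact hlk (((key x).1 h l k (Ne.symm hx.2)).1 (Ne.symm hx.1) hl)
    · refine Finset.sum_eq_zero fun k _ => if_neg fun h => hex ⟨k, h⟩

/-! ### A Sperner lemma on the alcove triangulation -/

namespace Alcove

variable {n : ℕ} [NeZero n]

/-- The move that transfers one unit from cell `i` to the (cyclically) preceding cell. -/
def transfer (i : ZMod n) : ZMod n → ℤ := Pi.single (i - 1) 1 - Pi.single i 1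

/-- A colouring of the lattice that increases by one along each `transfer`. -/
def colour (a : ZMod n → ℤ) : ZMod n := -∑ i, i * (a i : ZMod n)

theorem colour_add_transfer (a : ZMod n → ℤ) (i : ZMod n) :
    colour (a + transfer i) = colour a + 1 := by
  simp only [colour, transfer, Pi.add_apply, Pi.sub_apply, Int.cast_add, Int.cast_sub, mul_add,
    mul_sub, Finset.sum_add_distrib, Finset.sum_sub_distrib, Pi.single_apply]
  simp [add_comm]

theorem sum_add_transfer (a : ZMod n → ℤ) (i : ZMod n) :
    ∑ j, (a + transfer i) j = ∑ j, a j := by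
  simp [transfer, Finset.sum_add_distrib, Finset.sum_sub_distrib]

/-- The alcoves of the affine Weyl group of type `A` in the hyperplane `∑ i, x i = N`: the vertices
are listed by colour, and consecutive vertices differ by a transfer, each transfer being used
exactly once around the cycle. -/
structure IsAlcove (N : ℤ) (A : ZMod n → ZMod n → ℤ) (π : Equiv.Perm (ZMod n)) : Prop where
  step : ∀ c, A (c + 1) = A c + transfer (π c)
  colour_eq : ∀ c, colour (A c) = c
  sum_eq : ∀ c, ∑ i, A c i = N

/-- Replace the vertex of colour `k` of an alcove by its mirror image in the opposite facet. -/
def flip (k : ZMod n) (p : (ZMod n → ZMod n → ℤ) × Equiv.Perm (ZMod n)) :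
    (ZMod n → ZMod n → ℤ) × Equiv.Perm (ZMod n) :=
  (Function.update p.1 k (p.1 (k - 1) + transfer (p.2 k)), p.2 * Equiv.swap (k - 1) k)

/-- Transfers commute, so performing the two steps around vertex `k` in the opposite order changes
that vertex only. `hk` excludes `n = 1`. -/
theorem IsAlcove.flip {N : ℤ} {p : (ZMod n → ZMod n → ℤ) × Equiv.Perm (ZMod n)}
    (h : IsAlcove N p.1 p.2) {k : ZMod n} (hk : k - 1 ≠ k) :
    IsAlcove N (flip k p).1 (flip k p).2 where
  step c := by
    have h1 := h.step (k - 1)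
    have h2 := h.step k
    rw [sub_add_cancel] at h1
    simp only [Alcove.flip, Equiv.Perm.mul_apply]
    by_cases hc : c = k
    · subst hc
      have : c + 1 ≠ c := fun e => hk (by linear_combination -e)
      rw [Function.update_of_ne this, Function.update_self, Equiv.swap_apply_right, h2, h1]
      abel
    · by_cases hc' : c = k - 1
      · subst hc'
        rw [sub_add_cancel, Function.update_self, Function.update_of_ne hk, Equiv.swap_apply_left]
      · have : c + 1 ≠ k := fun e => hc' (by rw [← e]; ring)
        rw [Function.update_of_ne hc, Function.update_of_ne this,
          Equiv.swap_apply_of_ne_of_ne hc' hc, h.step]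
  colour_eq c := by
    simp only [Alcove.flip]
    by_cases hc : c = k
    · subst hc
      rw [Function.update_self, colour_add_transfer, h.colour_eq, sub_add_cancel]
    · rw [Function.update_of_ne hc, h.colour_eq]
  sum_eq c := by
    simp only [Alcove.flip]
    by_cases hc : c = k
    · subst hc
      rw [Function.update_self, sum_add_transfer, h.sum_eq]
    · rw [Function.update_of_ne hc, h.sum_eq]

theorem IsAlcove.flip_flip {N : ℤ} {p : (ZMod n → ZMod n → ℤ) × Equiv.Perm (ZMod n)}
    (h : IsAlcove N p.1 p.2) {k : ZMod n} (hk : k - 1 ≠ k) :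
    Alcove.flip k (Alcove.flip k p) = p := by
  have h1 := h.step (k - 1)
  rw [sub_add_cancel] at h1
  refine Prod.ext ?_ ?_
  · simp only [Alcove.flip, Function.update_idem, Equiv.Perm.mul_apply, Equiv.swap_apply_right]
    rw [Function.update_of_ne hk, ← h1, Function.update_eq_self]
  · simp [Alcove.flip, mul_assoc]

omit [NeZero n] in
theorem flip_ne {p : (ZMod n → ZMod n → ℤ) × Equiv.Perm (ZMod n)} {k : ZMod n} (hk : k - 1 ≠ k) :
    Alcove.flip k p ≠ p := by
  intro e
  have := congrArg (fun q => q.2 k) e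
  simp only [Alcove.flip, Equiv.Perm.mul_apply, Equiv.swap_apply_right] at this
  exact hk (p.2.injective this)

theorem IsAlcove.apply_add_natCast {N : ℤ} {A : ZMod n → ZMod n → ℤ} {π : Equiv.Perm (ZMod n)}
    (h : IsAlcove N A π) (c : ZMod n) (t : ℕ) :
    A (c + t) = A c + ∑ s ∈ Finset.range t, transfer (π (c + s)) := by
  induction t with
  | zero => simp
  | succ t ih =>
    rw [Finset.sum_range_succ, Nat.cast_succ, ← add_assoc, h.step, ih, add_assoc]

/-- The alcoves having `a` as a vertex. -/
def star (N : ℤ) (a : ZMod n → ℤ) : Set ((ZMod n → ZMod n → ℤ) × Equiv.Perm (ZMod n)) :=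
  {p | IsAlcove N p.1 p.2 ∧ p.1 (colour a) = a}

/-- One vertex and the permutation determine the alcove. -/
theorem finite_star (N : ℤ) (a : ZMod n → ℤ) : (star N a).Finite := by
  refine Set.Finite.of_finite_image (f := Prod.snd) (Set.toFinite _) ?_
  rintro ⟨A, π⟩ ⟨hA, hAa⟩ ⟨B, π'⟩ ⟨hB, hBa⟩ (rfl : π = π')
  refine Prod.ext (funext fun c => ?_) rfl
  have := hA.apply_add_natCast (colour a) (c - colour a).val
  have h2 := hB.apply_add_natCast (colour a) (c - colour a).val
  simp only at hAa hBa this h2 ⊢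
  rw [ZMod.natCast_zmod_val, add_sub_cancel, hAa] at this
  rw [ZMod.natCast_zmod_val, add_sub_cancel, hBa] at h2
  exact this.trans h2.symm

/-- The alcoves whose vertices carry all labels. -/
def full (N : ℤ) (lab : (ZMod n → ℤ) → ZMod n) :
    Set ((ZMod n → ZMod n → ℤ) × Equiv.Perm (ZMod n)) :=
  {p | IsAlcove N p.1 p.2 ∧ Function.Bijective fun c => lab (p.1 c)}

open Classical in
theorem ncard_full_inter_star (N : ℤ) (lab : (ZMod n → ℤ) → ZMod n) (a : ZMod n → ℤ) :
    ((full N lab ∩ star N a).ncard : ZMod 2) = ∑ p ∈ (finite_star N a).toFinset,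
      if Function.Bijective (fun c => lab (p.1 c)) then (1 : ZMod 2) else 0 := by
  rw [Finset.sum_boole, ← Set.ncard_coe_finset]
  congr 2
  ext p
  simp only [full, star, Set.mem_inter_iff, Set.mem_ofPred_eq, Finset.coe_filter,
    Set.Finite.mem_toFinset]
  tauto

/-- Expand each indicator for `lab` by `card_bijective_update_mod_two`. For `k ≠ colour a` the terms
cancel in pairs under `flip k`, which keeps the vertex `a` and alters only the vertex whose label is
overwritten. The term `k = colour a` counts exactly the full alcoves of the updated labelling. -/
theorem ncard_full_update_inter_star (N : ℤ) (lab : (ZMod n → ℤ) → ZMod n) (a : ZMod n → ℤ)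
    (j : ZMod n) :
    ((full N (Function.update lab a j) ∩ star N a).ncard : ZMod 2) =
      (full N lab ∩ star N a).ncard := by
  classical
  rw [ncard_full_inter_star, ncard_full_inter_star]
  have h1 : ∀ p : (ZMod n → ZMod n → ℤ) × Equiv.Perm (ZMod n),
      (if Function.Bijective (fun c => lab (p.1 c)) then (1 : ZMod 2) else 0) =
      ∑ k, if Function.Bijective (Function.update (fun c => lab (p.1 c)) k j) then 1 else 0 :=
    fun p => (card_bijective_update_mod_two _ j).symm
  rw [Finset.sum_congr rfl fun p _ => h1 p, Finset.sum_comm,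
    Finset.sum_eq_single (colour a)]
  · refine Finset.sum_congr rfl fun p hp => ?_
    rw [Set.Finite.mem_toFinset] at hp
    obtain ⟨hA, ha⟩ := hp
    congr 3
    ext c
    by_cases hc : c = colour a
    · rw [hc, ha]; simp
    · rw [Function.update_of_ne hc, Function.update_of_ne]
      intro e
      exact hc (by rw [← e, hA.colour_eq])
  · intro k _ hk
    have hk1 : k - 1 ≠ k := by
      intro e
      have : (1 : ZMod n) = 0 := by linear_combination -e
      exact hk (by rw [← mul_one k, ← mul_one (colour a), this, mul_zero, mul_zero])
    refine Finset.sum_involution (fun p _ => Alcove.flip k p) ?_ ?_ ?_ ?_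
    · intro p _
      have : Function.update (fun c => lab ((Alcove.flip k p).1 c)) k j =
          Function.update (fun c => lab (p.1 c)) k j := by
        ext c
        by_cases hc : c = k
        · simp [hc]
        · simp [hc, Alcove.flip]
      rw [this]
      exact CharTwo.add_self_eq_zero _
    · intro p _ _
      exact flip_ne hk1
    · intro p hp
      rw [Set.Finite.mem_toFinset] at hp ⊢
      refine ⟨hp.1.flip hk1, ?_⟩
      simp only [Alcove.flip]
      rw [Function.update_of_ne hk.symm, hp.2]
    · intro p hp
      rw [Set.Finite.mem_toFinset] at hp
      exact hp.1.flip_flip hk1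
  · simp

theorem full_update_diff_star (N : ℤ) (lab : (ZMod n → ℤ) → ZMod n) (a : ZMod n → ℤ)
    (j : ZMod n) : full N (Function.update lab a j) \ star N a = full N lab \ star N a := by
  ext p
  simp only [full, star, Set.mem_sdiff, Set.mem_ofPred_eq]
  constructor
  all_goals
    rintro ⟨⟨hA, hb⟩, hs⟩
    refine ⟨⟨hA, ?_⟩, hs⟩
    convert hb using 2 with c
    have : p.1 c ≠ a := by
      rintro rfl
      exact hs ⟨hA, by rw [hA.colour_eq]⟩
    simp [this]

theorem finite_and_odd_full_update {N : ℤ} {lab : (ZMod n → ℤ) → ZMod n}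
    (h : (full N lab).Finite ∧ Odd (full N lab).ncard) (a : ZMod n → ℤ) (j : ZMod n) :
    (full N (Function.update lab a j)).Finite ∧
      Odd (full N (Function.update lab a j)).ncard := by
  have hfin : (full N (Function.update lab a j)).Finite := by
    refine ((h.1.sdiff (t := star N a)).union (finite_star N a)).subset ?_
    rw [← full_update_diff_star N lab a j, Set.sdiff_union_self]
    exact Set.subset_union_left
  refine ⟨hfin, ?_⟩
  have h2 := h.2
  rw [← ZMod.natCast_eq_one_iff_odd] at h2 ⊢
  rw [← Set.ncard_inter_add_ncard_sdiff_eq_ncard _ (star N a) hfin, full_update_diff_star,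
    Nat.cast_add, ncard_full_update_inter_star, ← Nat.cast_add,
    Set.ncard_inter_add_ncard_sdiff_eq_ncard _ (star N a) h.1, h2]

theorem finite_and_odd_full_of_eq_off {N : ℤ} {lab : (ZMod n → ℤ) → ZMod n}
    (h : (full N lab).Finite ∧ Odd (full N lab).ncard) (S : Finset (ZMod n → ℤ)) :
    ∀ lab' : (ZMod n → ℤ) → ZMod n, (∀ a, a ∉ S → lab' a = lab a) →
      (full N lab').Finite ∧ Odd (full N lab').ncard := by
  classical
  induction S using Finset.induction_on with
  | empty =>
    intro lab' h'
    rwa [show lab' = lab from funext fun a => h' a (by simp)]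
  | insert b S _ ih =>
    intro lab' h'
    have := finite_and_odd_full_update (ih (Function.update lab' b (lab b)) ?_) b (lab' b)
    · rwa [Function.update_idem, Function.update_eq_self] at this
    · intro a ha
      by_cases hab : a = b
      · simp [hab]
      · rw [Function.update_of_ne hab]
        exact h' a (by simp [hab, ha])

/-- Going from `c` to `c'` takes fewer than `n` steps, so no transfer repeats, and only `transfer (i
+ 1)` can raise coordinate `i`. -/
theorem IsAlcove.apply_le_apply_add_one {N : ℤ} {A : ZMod n → ZMod n → ℤ}
    {π : Equiv.Perm (ZMod n)} (h : IsAlcove N A π) (c c' i : ZMod n) : A c' i ≤ A c i + 1 := by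
  have := congrFun (h.apply_add_natCast c (c' - c).val) i
  rw [ZMod.natCast_zmod_val, add_sub_cancel] at this
  rw [this, Pi.add_apply, Finset.sum_apply]
  gcongr
  set t := (c' - c).val
  have ht : t < n := ZMod.val_lt _
  have hinj : Set.InjOn (fun s : ℕ => π (c + s)) (Finset.range t) := by
    intro s hs s' hs' e
    simp only [Finset.coe_range, Set.mem_Iio] at hs hs'
    have e' := add_left_cancel (π.injective e)
    rw [ZMod.natCast_eq_natCast_iff', Nat.mod_eq_of_lt (by omega), Nat.mod_eq_of_lt (by omega)]
      at e'
    exact e'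
  calc ∑ s ∈ Finset.range t, transfer (π (c + s)) i
      ≤ ∑ s ∈ Finset.range t, (if π (c + s) = i + 1 then (1 : ℤ) else 0) := by
        refine Finset.sum_le_sum fun s _ => ?_
        simp only [transfer, Pi.sub_apply, Pi.single_apply]
        have : (i = π (c + s) - 1) ↔ π (c + s) = i + 1 := by
          rw [eq_sub_iff_add_eq, eq_comm]
        simp only [this]
        have : (0 : ℤ) ≤ if i = π (c + s) then 1 else 0 := by split_ifs <;> simp
        linarith
    _ = ∑ x ∈ (Finset.range t).image (fun s : ℕ => π (c + s)),
          (if x = i + 1 then (1 : ℤ) else 0) := (Finset.sum_image (f := fun x => if x = i + 1 then (1 : ℤ) else 0) hinj).symm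
    _ ≤ ∑ x, (if x = i + 1 then (1 : ℤ) else 0) :=
        Finset.sum_le_sum_of_subset_of_nonneg (Finset.subset_univ _) fun x _ _ => by
          split_ifs <;> simp
    _ = 1 := by simp

/-- Some vertex carries label `i`, so its coordinate `i` is at least one, and coordinates vary by at
most one within an alcove. This confines full alcoves to the simplex although the lattice has no
boundary. -/
theorem nonneg_of_mem_full {N : ℤ} {lab : (ZMod n → ℤ) → ZMod n}
    (hlab : ∀ a : ZMod n → ℤ, ∑ i, a i = N → 0 < a (lab a))
    {p : (ZMod n → ZMod n → ℤ) × Equiv.Perm (ZMod n)} (hp : p ∈ full N lab) (c i : ZMod n) :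
    0 ≤ p.1 c i := by
  obtain ⟨c', rfl⟩ := hp.2.2 i
  have h1 := hlab _ (hp.1.sum_eq c')
  have h2 := hp.1.apply_le_apply_add_one c c' (lab (p.1 c'))
  simp only
  linarith

omit [NeZero n] in
theorem transfer_injective : Function.Injective (transfer : ZMod n → ZMod n → ℤ) := by
  intro i j h
  by_cases h1 : (1 : ZMod n) = 0
  · rw [← mul_one i, ← mul_one j, h1, mul_zero, mul_zero]
  · have e := congrFun h i
    have hi : i ≠ i - 1 := fun e => h1 (by linear_combination e)
    simp only [transfer, Pi.sub_apply, Pi.single_apply, if_neg hi, if_true] at e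
    by_contra hij
    rw [if_neg hij] at e
    split_ifs at e <;> simp at e

open Classical in
/-- A labelling of the lattice by positive coordinates that avoids the label `-1` if possible. -/
noncomputable def baseLabel (a : ZMod n → ℤ) : ZMod n :=
  if h : ∃ j, j ≠ -1 ∧ 0 < a j then h.choose else -1

theorem baseLabel_pos {N : ℤ} (hN : 0 < N) (a : ZMod n → ℤ) (ha : ∑ i, a i = N) :
    0 < a (baseLabel a) := by
  unfold baseLabel
  split_ifs with h
  · exact h.choose_spec.2
  · by_contra h'
    push Not at h
    have : ∑ i, a i ≤ 0 := Finset.sum_nonpos fun i _ => by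
      by_cases hi : i = -1
      · rw [hi]; exact not_lt.1 h'
      · exact h i hi
    omega

theorem baseLabel_single (N : ℤ) (j : ZMod n) :
    baseLabel (Pi.single j 1 + Pi.single (-1) (N - 1)) = j := by
  have key : ∀ i : ZMod n, i ≠ -1 →
      0 < (Pi.single j 1 + Pi.single (-1) (N - 1) : ZMod n → ℤ) i → i = j := by
    intro i hi h
    by_contra hij
    simp [hi, hij] at h
  unfold baseLabel
  split_ifs with h
  · exact key _ h.choose_spec.1 h.choose_spec.2
  · by_contra hj
    exact h ⟨j, Ne.symm hj, by simp [Ne.symm hj]⟩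

/-- The vertex labelled `-1` has no other positive coordinate, so it is the corner `N e₋₁`; every
other vertex is within one of it in each coordinate. -/
theorem eq_single_of_mem_full_baseLabel {N : ℤ} (hN : 0 < N)
    {p : (ZMod n → ZMod n → ℤ) × Equiv.Perm (ZMod n)} (hp : p ∈ full N baseLabel) (c : ZMod n) :
    p.1 c = Pi.single (baseLabel (p.1 c)) 1 + Pi.single (-1) (N - 1) := by
  have hnn := nonneg_of_mem_full (baseLabel_pos hN) hp
  obtain ⟨d, hd⟩ := hp.2.2 (-1)
  simp only at hd
  have hd0 : ∀ i, i ≠ -1 → p.1 d i = 0 := by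
    intro i hi
    refine le_antisymm ?_ (hnn d i)
    by_contra hlt
    unfold baseLabel at hd
    have hex : ∃ j, j ≠ -1 ∧ 0 < p.1 d j := ⟨i, hi, not_le.1 hlt⟩
    rw [dif_pos hex] at hd
    exact hex.choose_spec.1 hd
  have hdN : p.1 d (-1) = N := by
    rw [← hp.1.sum_eq d, Finset.sum_eq_single (-1) (fun i _ hi => hd0 i hi) (by simp)]
  by_cases hj : baseLabel (p.1 c) = -1
  · have : c = d := hp.2.1 (by simp only; rw [hj, hd])
    subst this
    rw [hj]
    ext i
    by_cases hi : i = -1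
    · simp [hi, hdN]
    · simp [hi, hd0 i hi]
  · have hpos := baseLabel_pos hN _ (hp.1.sum_eq c)
    set j := baseLabel (p.1 c)
    have h1 := hp.1.apply_le_apply_add_one d c j
    have h2 := hp.1.apply_le_apply_add_one c d (-1)
    rw [hd0 j hj] at h1
    rw [hdN] at h2
    have hsum := hp.1.sum_eq c
    rw [← Finset.add_sum_erase _ _ (Finset.mem_univ (-1)), ← Finset.add_sum_erase _ _
      (show j ∈ Finset.univ.erase (-1) by simp [hj])] at hsum
    have hrest : ∀ i ∈ (Finset.univ.erase (-1)).erase j, 0 ≤ p.1 c i := fun i _ => hnn c i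
    have hr := Finset.sum_nonneg hrest
    have hzero : ∑ i ∈ (Finset.univ.erase (-1)).erase j, p.1 c i = 0 := by omega
    rw [Finset.sum_eq_zero_iff_of_nonneg hrest] at hzero
    ext i
    by_cases hi : i = -1
    · subst hi
      simp [Ne.symm hj]
      omega
    · by_cases hij : i = j
      · rw [hij]
        simp [hj]
        omega
      · rw [hzero i (by simp [hi, hij])]
        simp [hi, hij]

/-- The colour fixes which neighbour of the corner sits at each index, and the differences of
consecutive vertices then fix the permutation. -/
theorem full_baseLabel {N : ℤ} (hN : 0 < N) :
    full (n := n) N baseLabel =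
      {(fun c => Pi.single ((N : ZMod n) - 1 - c) 1 + Pi.single (-1) (N - 1),
        Equiv.subLeft ((N : ZMod n) - 1))} := by
  have hcol : ∀ j : ZMod n, colour (Pi.single j 1 + Pi.single (-1) (N - 1)) = (N : ZMod n) - 1 - j := by
    intro j
    simp only [colour, Pi.add_apply, Int.cast_add, mul_add, Finset.sum_add_distrib,
      Pi.single_apply]
    simp
    ring
  ext p
  rw [Set.mem_singleton_iff]
  constructor
  · intro hp
    have h1 : p.1 = fun c => Pi.single ((N : ZMod n) - 1 - c) 1 + Pi.single (-1) (N - 1) := by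
      ext1 c
      have h := eq_single_of_mem_full_baseLabel hN hp c
      have h2 := hp.1.colour_eq c
      rw [h, hcol] at h2
      rw [h]
      congr 2
      linear_combination -h2
    refine Prod.ext h1 (Equiv.ext fun c => transfer_injective ?_)
    have h3 := hp.1.step c
    simp only [h1] at h3
    rw [add_right_comm, add_left_inj, ← sub_eq_iff_eq_add'] at h3
    rw [← h3, transfer, Equiv.subLeft_apply, ← sub_sub]
  · rintro rfl
    refine ⟨⟨fun c => ?_, fun c => ?_, fun c => ?_⟩, ?_⟩
    · simp only [transfer, Equiv.subLeft_apply, ← sub_sub]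
      abel
    · simp only [hcol]
      ring
    · simp [Finset.sum_add_distrib]
    · simp only [baseLabel_single]
      exact (Equiv.subLeft ((N : ZMod n) - 1)).bijective

/-- A Sperner-type lemma: if each nonnegative lattice point of the hyperplane `∑ i, a i = N` is
labelled by one of its positive coordinates, then some alcove carries all labels. -/
theorem exists_full {N : ℤ} (hN : 0 < N) (lab : (ZMod n → ℤ) → ZMod n)
    (hlab : ∀ a : ZMod n → ℤ, (∀ i, 0 ≤ a i) → ∑ i, a i = N → 0 < a (lab a)) :
    ∃ (A : ZMod n → ZMod n → ℤ) (π : Equiv.Perm (ZMod n)), IsAlcove N A π ∧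
      (∀ c i, 0 ≤ A c i) ∧ Function.Bijective fun c => lab (A c) := by
  classical
  set S : Finset (ZMod n → ℤ) := Fintype.piFinset fun _ => Finset.Icc 0 N
  have hS : ∀ a : ZMod n → ℤ, (∀ i, 0 ≤ a i) → ∑ i, a i = N → a ∈ S := by
    intro a ha hs
    rw [Fintype.mem_piFinset]
    intro i
    rw [Finset.mem_Icc]
    exact ⟨ha i, hs ▸ Finset.single_le_sum (fun j _ => ha j) (Finset.mem_univ i)⟩
  -- The cube `S` is finite, so `lab'` arises from `baseLabel` by finitely many relabellings and
  -- keeps its odd count.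
  let lab' : (ZMod n → ℤ) → ZMod n := fun a => if a ∈ S then lab a else baseLabel a
  have hlab' : ∀ a : ZMod n → ℤ, ∑ i, a i = N → 0 < a (lab' a) := by
    intro a ha
    by_cases haS : a ∈ S
    · simp only [lab', if_pos haS]
      rw [Fintype.mem_piFinset] at haS
      exact hlab a (fun i => (Finset.mem_Icc.1 (haS i)).1) ha
    · simp only [lab', if_neg haS]
      exact baseLabel_pos hN a ha
  have hbase : (full (n := n) N baseLabel).Finite ∧ Odd (full (n := n) N baseLabel).ncard := by
    rw [full_baseLabel hN]
    simp
  have hodd := (finite_and_odd_full_of_eq_off hbase S lab' fun a ha => if_neg ha).2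
  obtain ⟨p, hp⟩ := Set.nonempty_of_ncard_ne_zero hodd.pos.ne'
  have hnn := nonneg_of_mem_full hlab' hp
  refine ⟨p.1, p.2, hp.1, hnn, ?_⟩
  convert hp.2 using 2 with c
  exact (if_pos (hS _ (hnn c) (hp.1.sum_eq c))).symm

end Alcove

/-! ### Equilibrium for continuous preferences on the simplex -/

-- Each lattice vertex is assigned to the agent given by its colour and labelled with a favourite
-- positive coordinate of that agent. A full alcove then gives distinct favourites at points `1 / (t
-- + 1)` apart, and compactness brings the points together.
open Filter Topology in
theorem exists_perm_forall_le_zmod {n : ℕ} [NeZero n]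
    (U : ZMod n → ZMod n → (ZMod n → ℝ) → ℝ)
    (hU : ∀ i j, ContinuousOn (U i j) (stdSimplex ℝ (ZMod n)))
    (hpos : ∀ i, ∀ y ∈ stdSimplex ℝ (ZMod n), ∃ j, 0 < y j ∧ ∀ j', U i j' y ≤ U i j y) :
    ∃ y ∈ stdSimplex ℝ (ZMod n), ∃ σ : Equiv.Perm (ZMod n), ∀ i j, U i j y ≤ U i (σ i) y := by
  classical
  have approx : ∀ t : ℕ, ∃ (z : ZMod n → ZMod n → ℝ) (σ : Equiv.Perm (ZMod n)),
      (∀ c, z c ∈ stdSimplex ℝ (ZMod n)) ∧ (∀ c c' i, z c' i ≤ z c i + 1 / ((t : ℝ) + 1)) ∧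
      ∀ c j, U c j (z c) ≤ U c (σ c) (z c) := by
    intro t
    have ht : (0 : ℝ) < t + 1 := by positivity
    let scale : (ZMod n → ℤ) → ZMod n → ℝ := fun a i => a i / ((t : ℝ) + 1)
    have hscale : ∀ a : ZMod n → ℤ, (∀ i, 0 ≤ a i) → ∑ i, a i = (t : ℤ) + 1 →
        scale a ∈ stdSimplex ℝ (ZMod n) := by
      intro a ha hs
      refine ⟨fun i => div_nonneg (by exact_mod_cast ha i) ht.le, ?_⟩
      have : ∑ i, (a i : ℝ) = t + 1 := by exact_mod_cast hs
      simp only [scale]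
      rw [← Finset.sum_div, this, div_self ht.ne']
    let lab : (ZMod n → ℤ) → ZMod n := fun a =>
      if h : scale a ∈ stdSimplex ℝ (ZMod n) then (hpos (Alcove.colour a) _ h).choose else 0
    have hlab : ∀ a, scale a ∈ stdSimplex ℝ (ZMod n) → 0 < scale a (lab a) ∧
        ∀ j, U (Alcove.colour a) j (scale a) ≤ U (Alcove.colour a) (lab a) (scale a) := by
      intro a h
      simp only [lab, dif_pos h]
      exact (hpos (Alcove.colour a) _ h).choose_spec
    obtain ⟨A, π, hA, hnn, hbij⟩ := Alcove.exists_full (N := (t : ℤ) + 1) (by positivity) lab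
      fun a ha hs => by
        have := (hlab a (hscale a ha hs)).1
        simp only [scale] at this
        rw [div_pos_iff_of_pos_right ht] at this
        exact_mod_cast this
    refine ⟨fun c => scale (A c), Equiv.ofBijective _ hbij, fun c => hscale _ (hnn c) (hA.sum_eq c),
      fun c c' i => ?_, fun c j => ?_⟩
    · simp only [scale]
      rw [← add_div]
      gcongr
      exact_mod_cast hA.apply_le_apply_add_one c c' i
    · have := (hlab (A c) (hscale _ (hnn c) (hA.sum_eq c))).2 j
      rwa [hA.colour_eq c] at this
  choose z σ hz hclose hle using approx
  obtain ⟨y, hy, hlim⟩ := (isCompact_stdSimplex (𝕜 := ℝ) (ι := ZMod n)).ultrafilter_le_nhds'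
    ((hyperfilter ℕ : Ultrafilter ℕ).map fun t => z t 0)
    (Ultrafilter.mem_map.2 (Filter.univ_mem' fun t => hz t 0))
  have hlim0 : Tendsto (fun t => z t 0) (hyperfilter ℕ) (𝓝 y) := hlim
  have hinv : Tendsto (fun t : ℕ => 1 / ((t : ℝ) + 1)) (hyperfilter ℕ) (𝓝 0) :=
    tendsto_one_div_add_atTop_nhds_zero_nat.mono_left Nat.hyperfilter_le_atTop
  have hlimc : ∀ c, Tendsto (fun t => z t c) (hyperfilter ℕ)
      (𝓝[stdSimplex ℝ (ZMod n)] y) := by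
    intro c
    refine tendsto_nhdsWithin_iff.2 ⟨tendsto_pi_nhds.2 fun i => ?_, Eventually.of_forall
      fun t => hz t c⟩
    have h0 := tendsto_pi_nhds.1 hlim0 i
    refine tendsto_of_tendsto_of_tendsto_of_le_of_le (g := fun t => z t 0 i - 1 / ((t : ℝ) + 1))
      (h := fun t => z t 0 i + 1 / ((t : ℝ) + 1)) (by simpa using h0.sub hinv)
      (by simpa using h0.add hinv) (fun t => ?_) (fun t => hclose t 0 c i)
    have := hclose t c 0 i
    simp only
    linarith
  -- There are finitely many permutations, so along the ultrafilter `σ t` is eventually constant.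
  obtain ⟨τ, hτ⟩ := Ultrafilter.eq_pure_of_finite ((hyperfilter ℕ : Ultrafilter ℕ).map σ)
  have hev : ∀ᶠ t in (hyperfilter ℕ : Filter ℕ), σ t = τ := by
    have : {τ} ∈ (hyperfilter ℕ : Ultrafilter ℕ).map σ := by
      rw [hτ]
      exact Ultrafilter.mem_pure.2 rfl
    exact this
  refine ⟨y, hy, τ, fun i j => ?_⟩
  refine le_of_tendsto_of_tendsto ((hU i j y hy).tendsto.comp (hlimc i))
    ((hU i (τ i) y hy).tendsto.comp (hlimc i)) ?_
  filter_upwards [hev] with t ht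
  rw [← ht]
  exact hle t i j

/-- Equilibrium theorem for continuous preferences on the simplex: if at every point every agent
has a favourite coordinate that is positive there, then at some point the favourite coordinates of
the agents can be chosen to be distinct. -/
theorem exists_perm_forall_le {ι : Type*} [Fintype ι] [Nonempty ι]
    (U : ι → ι → (ι → ℝ) → ℝ)
    (hU : ∀ i j, ContinuousOn (U i j) (stdSimplex ℝ ι))
    (hpos : ∀ i, ∀ y ∈ stdSimplex ℝ ι, ∃ j, 0 < y j ∧ ∀ j', U i j' y ≤ U i j y) :
    ∃ y ∈ stdSimplex ℝ ι, ∃ σ : Equiv.Perm ι, ∀ i j, U i j y ≤ U i (σ i) y := by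
  have : NeZero (Fintype.card ι) := ⟨Fintype.card_ne_zero⟩
  let e : ZMod (Fintype.card ι) ≃ ι :=
    (ZMod.finEquiv (Fintype.card ι)).toEquiv.symm.trans (Fintype.equivFin ι).symm
  have hmaps : ∀ y ∈ stdSimplex ℝ (ZMod (Fintype.card ι)), y ∘ e.symm ∈ stdSimplex ℝ ι := by
    intro y hy
    refine ⟨fun i => hy.1 _, ?_⟩
    rw [← hy.2]
    exact Equiv.sum_comp e.symm y
  obtain ⟨y, hy, σ, hσ⟩ := exists_perm_forall_le_zmod
    (fun i j y => U (e i) (e j) (y ∘ e.symm))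
    (fun i j => (hU _ _).comp
      (continuous_pi fun l => continuous_apply (e.symm l)).continuousOn hmaps)
    (fun i y hy => by
      obtain ⟨j, hj, hmax⟩ := hpos (e i) _ (hmaps y hy)
      exact ⟨e.symm j, hj, fun j' => by simpa using hmax (e j')⟩)
  refine ⟨_, hmaps y hy, (e.symm.trans σ).trans e, fun i j => ?_⟩
  simpa using hσ (e.symm i) (e.symm j)

/-! ### Boosted values -/

/-- The value of `[a, b]` under the distribution function `F`, with the part inside `[p, q]`
counted twice as long as it is at most half of the value of `[p, q]`, and counted as the whole value
of `[p, q]` beyond. -/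
def boostedValue (F : ℝ → ℝ) (p q a b : ℝ) : ℝ :=
  F b - F a + min (F q - F p - (F (max p (min q b)) - F (max p (min q a))))
    (F (max p (min q b)) - F (max p (min q a)))

section Boosted

variable {F : ℝ → ℝ} {p q a b : ℝ}

theorem boostedValue_self : boostedValue F p q a a ≤ 0 := by
  simp [boostedValue]

theorem Continuous.boostedValue {X : Type*} [TopologicalSpace X] (hF : Continuous F)
    {f g : X → ℝ} (hf : Continuous f) (hg : Continuous g) :
    Continuous fun x => boostedValue F p q (f x) (g x) := by
  unfold _root_.boostedValue
  fun_prop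

variable (hF : Monotone F)
include hF

theorem le_boostedValue (hpq : p ≤ q) (hab : a ≤ b) : F b - F a ≤ boostedValue F p q a b := by
  have h1 : F (max p (min q b)) ≤ F q := hF (max_le hpq (min_le_left _ _))
  have h2 : F p ≤ F (max p (min q a)) := hF (le_max_left _ _)
  have h3 : F (max p (min q a)) ≤ F (max p (min q b)) :=
    hF (max_le_max_left _ (min_le_min_left _ hab))
  rw [boostedValue, le_add_iff_nonneg_right, le_min_iff]
  constructor <;> linarith

/-- `F` is constant on `[a, b]`, so clamping the ends to `[p, q]` cannot create an increment. -/
theorem boostedValue_nonpos (h : F a = F b) (hab : a ≤ b) :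
    boostedValue F p q a b ≤ 0 := by
  have h1 : F (max p (min q b)) ≤ F (max p (min q a)) := by
    rcases le_total (min q a) p with h1 | h1
    · rw [max_eq_left h1]
      rcases le_total (min q b) p with h2 | h2
      · rw [max_eq_left h2]
      · rw [max_eq_right h2]
        rcases min_le_iff.1 h1 with h3 | h3
        · exact hF ((min_le_left _ _).trans h3)
        · exact (hF (min_le_right q b)).trans (h ▸ hF h3)
    · rw [max_eq_right h1]
      rcases le_total q a with h3 | h3
      · rw [min_eq_left h3]
        rw [min_eq_left h3] at h1
        exact hF (max_le h1 (min_le_left _ _))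
      · rw [min_eq_right h3] at h1 ⊢
        rw [h]
        exact hF (max_le (h1.trans hab) (min_le_right _ _))
  have := min_le_right (F q - F p - (F (max p (min q b)) - F (max p (min q a))))
    (F (max p (min q b)) - F (max p (min q a)))
  rw [boostedValue]
  linarith

end Boosted

/-! ### Rounding the cuts -/

/-- An envy-free partition for the boosted values can be rounded to an envy-free partition in which
every player gets at least the value of his distinguished interval. -/
theorem exists_rounded_cuts {n : ℕ} {F : Fin n → ℝ → ℝ} (hF : ∀ i, Monotone (F i))
    (hF01 : ∀ i, F i 0 < F i 1) {p q : Fin n → ℝ} (hpq : ∀ i, p i ≤ q i) (hp : ∀ i, 0 ≤ p i)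
    (hq : ∀ i, q i ≤ 1) (hsep : ∀ i l, i ≠ l → q i ≤ p l ∨ q l ≤ p i)
    (hzero : ∀ i l, l ≠ i → F l (p i) = F l (q i)) {X : Fin (n + 1) → ℝ} (hX : Monotone X)
    (hX0 : X 0 = 0) (hX1 : X (Fin.last n) = 1) {σ : Equiv.Perm (Fin n)}
    (hσ : ∀ (i s : Fin n), boostedValue (F i) (p i) (q i) (X s.castSucc) (X s.succ) ≤
      boostedValue (F i) (p i) (q i) (X (σ i).castSucc) (X (σ i).succ)) :
    ∃ Y : Fin (n + 1) → ℝ, Monotone Y ∧ Y 0 = 0 ∧ Y (Fin.last n) = 1 ∧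
      (∀ (i s : Fin n), F i (Y s.succ) - F i (Y s.castSucc) ≤
        F i (Y (σ i).succ) - F i (Y (σ i).castSucc)) ∧
      ∀ i, F i (q i) - F i (p i) ≤ F i (Y (σ i).succ) - F i (Y (σ i).castSucc) := by
  have hXs : ∀ s : Fin n, X s.castSucc ≤ X s.succ := fun s => hX (Fin.castSucc_lt_succ).le
  have hcs : ∀ s : Fin n, s.castSucc ≠ s.succ := fun s => (Fin.castSucc_lt_succ).ne
  have huniq : ∀ i l x, x ∈ Ioo (p i) (q i) → x ∈ Ioo (p l) (q l) → i = l := by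
    intro i l x hi hl
    by_contra hne
    rcases hsep i l hne with h | h
    · exact absurd (hl.1.trans hi.2) (not_lt.2 h)
    · exact absurd (hi.1.trans hl.2) (not_lt.2 h)
  have hconst : ∀ i l x y, l ≠ i → x ∈ Icc (p i) (q i) → y ∈ Icc (p i) (q i) →
      F l x ≤ F l y := fun i l x y hl hx hy =>
    (hF l hx.2).trans ((hzero i l hl).symm.le.trans (hF l hy.1))
  -- Otherwise every interval is worthless to `i`, against his positive value for the whole cake.
  have hpos : ∀ i, 0 < boostedValue (F i) (p i) (q i) (X (σ i).castSucc) (X (σ i).succ) := by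
    intro i
    by_contra hle
    have : ∀ j, F i (X j) ≤ F i (X 0) := by
      intro j
      induction j using Fin.induction with
      | zero => rfl
      | succ s ih =>
        have h1 := le_boostedValue (hF i) (hpq i) (hXs s)
        have h2 := hσ i s
        linarith
    have h := this (Fin.last n)
    rw [hX0, hX1] at h
    exact absurd h (not_le.2 (hF01 i))
  have hinside : ∀ i s, X s.castSucc ∈ Icc (p i) (q i) → X s.succ ∈ Icc (p i) (q i) →
      s = σ i := by
    intro i s h1 h2
    by_contra hne
    obtain ⟨l, rfl⟩ := σ.surjective s
    have hl : l ≠ i := fun h => hne (by rw [h])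
    exact absurd (hpos l) (not_lt.2 (boostedValue_nonpos (hF l)
      (le_antisymm (hconst i l _ _ hl h1 h2) (hconst i l _ _ hl h2 h1)) (hXs _)))
  -- A cut moves only if it bounds the interval of the player whose distinguished piece contains it
  -- in its interior: a right end goes to `q i`, a left end to `p i`.
  have hexY : ∀ j, ∃ y,
      (∀ i, X j ∈ Ioo (p i) (q i) → (σ i).succ = j → y = q i) ∧
      (∀ i, X j ∈ Ioo (p i) (q i) → (σ i).castSucc = j → y = p i) ∧
      ((∀ i, X j ∈ Ioo (p i) (q i) → (σ i).succ ≠ j ∧ (σ i).castSucc ≠ j) → y = X j) := by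
    intro j
    by_cases h1 : ∃ i, X j ∈ Ioo (p i) (q i) ∧ (σ i).succ = j
    · obtain ⟨i, hi, hij⟩ := h1
      refine ⟨q i, fun l hl _ => by rw [huniq i l _ hi hl], fun l hl hlj => ?_, fun h => ?_⟩
      · obtain rfl := huniq i l _ hi hl
        exact absurd (hlj.trans hij.symm) (hcs _)
      · exact absurd hij (h i hi).1
    · by_cases h2 : ∃ i, X j ∈ Ioo (p i) (q i) ∧ (σ i).castSucc = j
      · obtain ⟨i, hi, hij⟩ := h2
        refine ⟨p i, fun l hl hlj => absurd ⟨l, hl, hlj⟩ h1,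
          fun l hl _ => by rw [huniq i l _ hi hl], fun h => ?_⟩
        exact absurd hij (h i hi).2
      · exact ⟨X j, fun l hl hlj => absurd ⟨l, hl, hlj⟩ h1,
          fun l hl hlj => absurd ⟨l, hl, hlj⟩ h2, fun _ => rfl⟩
  choose Y hYq hYp hYX using hexY
  have hYcases : ∀ j, Y j = X j ∨ ∃ i, X j ∈ Ioo (p i) (q i) ∧
      (((σ i).succ = j ∧ Y j = q i) ∨ ((σ i).castSucc = j ∧ Y j = p i)) := by
    intro j
    by_cases h : ∀ i, X j ∈ Ioo (p i) (q i) → (σ i).succ ≠ j ∧ (σ i).castSucc ≠ j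
    · exact Or.inl (hYX j h)
    · push Not at h
      obtain ⟨i, hi, h⟩ := h
      refine Or.inr ⟨i, hi, ?_⟩
      by_cases h' : (σ i).succ = j
      · exact Or.inl ⟨h', hYq j i hi h'⟩
      · exact Or.inr ⟨h h', hYp j i hi (h h')⟩
  have hYF : ∀ i j, F i (Y j) = F i (X j) ∨ (X j ∈ Ioo (p i) (q i) ∧
      (((σ i).succ = j ∧ Y j = q i) ∨ ((σ i).castSucc = j ∧ Y j = p i))) := by
    intro i j
    rcases hYcases j with h | ⟨l, hl, h⟩
    · exact Or.inl (by rw [h])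
    · by_cases hli : i = l
      · subst hli
        exact Or.inr ⟨hl, h⟩
      · left
        have hYl : Y j ∈ Icc (p l) (q l) := by
          rcases h with ⟨-, h⟩ | ⟨-, h⟩ <;> rw [h]
          · exact ⟨hpq l, le_rfl⟩
          · exact ⟨le_rfl, hpq l⟩
        exact le_antisymm (hconst l i _ _ hli hYl (Ioo_subset_Icc_self hl))
          (hconst l i _ _ hli (Ioo_subset_Icc_self hl) hYl)
  have hYend : ∀ j, (X j ≤ 0 ∨ 1 ≤ X j) → Y j = X j := by
    intro j h
    rcases hYcases j with h' | ⟨i, hi, -⟩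
    · exact h'
    · rcases h with h | h
      · exact absurd (hi.1.trans_le h) (not_lt.2 (hp i))
      · exact absurd (h.trans_lt hi.2) (not_lt.2 (hq i))
  -- Order could fail only if neighbouring cuts enclosed an interval inside one piece; by `hinside`
  -- it belongs to that piece's owner, and its ends move apart.
  have hYmono : Monotone Y := by
    rw [Fin.monotone_iff_le_succ]
    intro s
    have hmem : ∀ i j, (((σ i).succ = j ∧ Y j = q i) ∨ ((σ i).castSucc = j ∧ Y j = p i)) →
        p i ≤ Y j ∧ Y j ≤ q i := by
      rintro i j (⟨-, h⟩ | ⟨-, h⟩) <;> rw [h]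
      · exact ⟨hpq i, le_rfl⟩
      · exact ⟨le_rfl, hpq i⟩
    rcases hYcases s.castSucc with ha | ⟨i, hi, ha⟩ <;>
      rcases hYcases s.succ with hb | ⟨l, hl, hb⟩
    · rw [ha, hb]
      exact hXs s
    · by_cases hlt : p l < X s.castSucc
      · have ha' : X s.castSucc ∈ Ioo (p l) (q l) := ⟨hlt, (hXs s).trans_lt hl.2⟩
        have hs := hinside l s (Ioo_subset_Icc_self ha') (Ioo_subset_Icc_self hl)
        rw [hYp _ l ha' (by rw [hs])]
        exact (hmem l _ hb).1
      · rw [ha]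
        exact (not_lt.1 hlt).trans (hmem l _ hb).1
    · by_cases hlt : X s.succ < q i
      · have hb' : X s.succ ∈ Ioo (p i) (q i) := ⟨hi.1.trans_le (hXs s), hlt⟩
        have hs := hinside i s (Ioo_subset_Icc_self hi) (Ioo_subset_Icc_self hb')
        rw [hYq _ i hb' (by rw [hs])]
        exact (hmem i _ ha).2
      · rw [hb]
        exact (hmem i _ ha).2.trans (not_lt.1 hlt)
    · by_cases hil : i = l
      · subst hil
        have hs := hinside i s (Ioo_subset_Icc_self hi) (Ioo_subset_Icc_self hl)
        rw [hYp _ i hi (by rw [hs])]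
        exact (hmem i _ hb).1
      · rcases hsep i l hil with h | h
        · exact (hmem i _ ha).2.trans (h.trans (hmem l _ hb).1)
        · exact absurd (hi.1.trans_le (hXs s)) (not_lt.2 (hl.2.le.trans h))
  -- Of the two bounds in the `min`, `v - w` is what rounding adds when an end is inside the piece.
  -- With both ends outside, `w` is `0` or `v` and the boost vanishes.
  have hown : ∀ i, boostedValue (F i) (p i) (q i) (X (σ i).castSucc) (X (σ i).succ) ≤
      F i (Y (σ i).succ) - F i (Y (σ i).castSucc) := by
    intro i
    have hm := hF i (hpq i)
    have hXi := hXs (σ i)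
    have outside : ∀ x, x ∉ Ioo (p i) (q i) →
        (x ≤ p i ∧ max (p i) (min (q i) x) = p i) ∨ (q i ≤ x ∧ max (p i) (min (q i) x) = q i) := by
      intro x hx
      by_cases h : x ≤ p i
      · exact Or.inl ⟨h, by rw [min_eq_right (h.trans (hpq i)), max_eq_left h]⟩
      · have h' : q i ≤ x := not_lt.1 fun h' => hx ⟨not_le.1 h, h'⟩
        exact Or.inr ⟨h', by rw [min_eq_left h', max_eq_right (hpq i)]⟩
    have clamp : ∀ x, x ∈ Ioo (p i) (q i) → max (p i) (min (q i) x) = x := fun x hx => by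
      rw [min_eq_right hx.2.le, max_eq_right hx.1.le]
    have hYF' : ∀ j, X j ∉ Ioo (p i) (q i) → F i (Y j) = F i (X j) := fun j hj =>
      (hYF i j).resolve_right fun h => hj h.1
    unfold boostedValue
    by_cases ha : X (σ i).castSucc ∈ Ioo (p i) (q i) <;>
      by_cases hb : X (σ i).succ ∈ Ioo (p i) (q i)
    · rw [hYp _ i ha rfl, hYq _ i hb rfl, clamp _ ha, clamp _ hb]
      have := min_le_left (F i (q i) - F i (p i) - (F i (X (σ i).succ) - F i (X (σ i).castSucc)))
        (F i (X (σ i).succ) - F i (X (σ i).castSucc))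
      linarith
    · rw [hYp _ i ha rfl, hYF' _ hb, clamp _ ha]
      rcases outside _ hb with ⟨h, -⟩ | ⟨-, h⟩
      · exact absurd (ha.1.trans_le (hXi.trans h)) (lt_irrefl _)
      · rw [h]
        have := min_le_left (F i (q i) - F i (p i) - (F i (q i) - F i (X (σ i).castSucc)))
          (F i (q i) - F i (X (σ i).castSucc))
        linarith
    · rw [hYq _ i hb rfl, hYF' _ ha, clamp _ hb]
      rcases outside _ ha with ⟨-, h⟩ | ⟨h, -⟩
      · rw [h]
        have := min_le_left (F i (q i) - F i (p i) - (F i (X (σ i).succ) - F i (p i)))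
          (F i (X (σ i).succ) - F i (p i))
        linarith
      · exact absurd (hb.2.trans_le (h.trans hXi)) (lt_irrefl _)
    · rw [hYF' _ ha, hYF' _ hb]
      rcases outside _ ha with ⟨-, h⟩ | ⟨h0, h⟩ <;> rcases outside _ hb with ⟨h1, h'⟩ | ⟨-, h'⟩ <;>
        rw [h, h']
      · simp
      · simp [hm]
      · simp
        right
        have : p i = q i := le_antisymm (hpq i) (h0.trans (hXi.trans h1))
        rw [this]
      · simp
  refine ⟨Y, hYmono, by rw [hYend 0 (Or.inl hX0.le), hX0],
    by rw [hYend _ (Or.inr hX1.ge), hX1], fun i s => ?_, fun i => ?_⟩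
  · by_cases hs : s = σ i
    · rw [hs]
    -- In the eyes of `i`, a cut bounding another interval moves, if at all, into that interval.
    · have h1 : F i (Y s.succ) ≤ F i (X s.succ) := by
        rcases hYF i s.succ with h | ⟨h, ⟨h', -⟩ | ⟨-, h'⟩⟩
        · exact h.le
        · exact absurd (Fin.succ_injective _ h').symm hs
        · rw [h']
          exact hF i h.1.le
      have h2 : F i (X s.castSucc) ≤ F i (Y s.castSucc) := by
        rcases hYF i s.castSucc with h | ⟨h, ⟨-, h'⟩ | ⟨h', -⟩⟩
        · exact h.ge
        · rw [h']
          exact hF i h.2.le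
        · exact absurd (Fin.castSucc_injective _ h').symm hs
      have h3 := le_boostedValue (hF i) (hpq i) (hXs s)
      have h4 := hσ i s
      have h5 := hown i
      linarith
  · by_cases hpi : p i < 1
    · have hex : ∃ s : Fin n, X s.castSucc ≤ p i ∧ p i < X s.succ := by
        by_contra hne
        push Not at hne
        have : ∀ j, X j ≤ p i := by
          intro j
          induction j using Fin.induction with
          | zero => rw [hX0]; exact hp i
          | succ s ih => exact hne s ih
        have := this (Fin.last n)
        rw [hX1] at this
        exact absurd hpi (not_lt.2 this)
      obtain ⟨s, hs1, hs2⟩ := hex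
      have hs := (hσ i s).trans (hown i)
      rcases le_or_gt (q i) (X s.succ) with hqs | hqs
      · have h3 := le_boostedValue (hF i) (hpq i) (hXs s)
        have h1 := hF i hs1
        have h2 := hF i hqs
        linarith
      · have hlast : s.succ ≠ Fin.last n := by
          intro h
          rw [h, hX1] at hqs
          exact absurd hqs (not_lt.2 (hq i))
        obtain ⟨s', hs'⟩ := Fin.exists_castSucc_eq.2 hlast
        have hXs' := hXs s'
        rw [hs'] at hXs'
        rcases lt_or_ge (X s'.succ) (q i) with hlt | hge
        · have ha : X s'.castSucc ∈ Ioo (p i) (q i) := by rw [hs']; exact ⟨hs2, hqs⟩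
          have hb : X s'.succ ∈ Ioo (p i) (q i) := ⟨hs2.trans_le hXs', hlt⟩
          have := hinside i s' (Ioo_subset_Icc_self ha) (Ioo_subset_Icc_self hb)
          rw [← this, hYp _ i ha (by rw [this]), hYq _ i hb (by rw [this])]
        -- The piece is split by the single cut `X s.succ`; whichever part is worth more, its
        -- boosted value reaches the value of the whole piece.
        · have hs2' := (hσ i s').trans (hown i)
          rw [hs'] at hs2'
          unfold boostedValue at hs hs2'
          rw [min_eq_right hqs.le, max_eq_right hs2.le] at hs hs2'
          rw [min_eq_right (hs1.trans (hpq i)), max_eq_left hs1] at hs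
          rw [min_eq_left hge, max_eq_right (hpq i)] at hs2'
          have h1 := hF i hs1
          have h2 := hF i hge
          rcases min_choice (F i (q i) - F i (p i) - (F i (X s.succ) - F i (p i)))
            (F i (X s.succ) - F i (p i)) with h | h <;>
          rcases min_choice (F i (q i) - F i (p i) - (F i (q i) - F i (X s.succ)))
            (F i (q i) - F i (X s.succ)) with h' | h' <;>
          rw [h] at hs <;> rw [h'] at hs2' <;> linarith
    · have : q i ≤ p i := (hq i).trans (not_lt.1 hpi)
      have h1 := hF i this
      have h2 := hF i (hYmono (Fin.castSucc_lt_succ (i := σ i)).le)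
      linarith

/-! ### Cuts and the intervals between them -/

section Cuts

variable {n : ℕ}

/-- The cut points of the partition of `[0, 1]` into consecutive intervals of lengths `y`. -/
def cutPoint (y : Fin n → ℝ) (j : Fin (n + 1)) : ℝ :=
  ∑ l : Fin n, if l.castSucc < j then y l else 0

theorem continuous_cutPoint (j : Fin (n + 1)) : Continuous fun y : Fin n → ℝ => cutPoint y j := by
  unfold cutPoint
  refine continuous_finsetSum _ fun l _ => ?_
  split_ifs <;> fun_prop

theorem cutPoint_zero (y : Fin n → ℝ) : cutPoint y 0 = 0 := by
  simp [cutPoint]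

theorem cutPoint_last (y : Fin n → ℝ) : cutPoint y (Fin.last n) = ∑ l, y l := by
  simp [cutPoint, Fin.castSucc_lt_last]

theorem cutPoint_succ (y : Fin n → ℝ) (s : Fin n) :
    cutPoint y s.succ = cutPoint y s.castSucc + y s := by
  have : y s = ∑ l, if l = s then y l else 0 := by simp
  rw [cutPoint, cutPoint, this, ← Finset.sum_add_distrib]
  refine Finset.sum_congr rfl fun l _ => ?_
  simp only [Fin.castSucc_lt_castSucc_iff, Fin.castSucc_lt_succ_iff]
  rcases lt_trichotomy l s with h | h | h
  · simp [h, h.le, h.ne]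
  · simp [h]
  · simp [h.not_gt, h.not_ge, h.ne']

theorem monotone_cutPoint {y : Fin n → ℝ} (hy : ∀ i, 0 ≤ y i) : Monotone (cutPoint y) := by
  rw [Fin.monotone_iff_le_succ]
  intro s
  rw [cutPoint_succ]
  linarith [hy s]

theorem exists_envyFree_cuts_boosted (hn : n ≠ 0) {F : Fin n → ℝ → ℝ} (hF : ∀ i, Monotone (F i))
    (hFc : ∀ i, Continuous (F i)) (hF01 : ∀ i, F i 0 < F i 1) {p q : Fin n → ℝ}
    (hpq : ∀ i, p i ≤ q i) :
    ∃ X : Fin (n + 1) → ℝ, Monotone X ∧ X 0 = 0 ∧ X (Fin.last n) = 1 ∧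
      ∃ σ : Equiv.Perm (Fin n), ∀ i s : Fin n,
        boostedValue (F i) (p i) (q i) (X s.castSucc) (X s.succ) ≤
          boostedValue (F i) (p i) (q i) (X (σ i).castSucc) (X (σ i).succ) := by
  have : Nonempty (Fin n) := Fin.pos_iff_nonempty.1 (Nat.pos_of_ne_zero hn)
  obtain ⟨y, hy, σ, hσ⟩ := exists_perm_forall_le
    (fun (i s : Fin n) y => boostedValue (F i) (p i) (q i) (cutPoint y s.castSucc) (cutPoint y s.succ))
    (fun i s => ((hFc i).boostedValue (continuous_cutPoint _) (continuous_cutPoint _)).continuousOn)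
    (fun i y hy => by
      obtain ⟨s, hs⟩ := Finite.exists_max fun s : Fin n =>
        boostedValue (F i) (p i) (q i) (cutPoint y s.castSucc) (cutPoint y s.succ)
      -- If a favourite interval had length zero, all boosted values would be nonpositive and `F i`
      -- could not increase from `0` to `1`.
      refine ⟨s, (hy.1 s).lt_of_ne' fun h0 => ?_, hs⟩
      have hle : ∀ j, F i (cutPoint y j) ≤ F i (cutPoint y 0) := by
        intro j
        induction j using Fin.induction with
        | zero => rfl
        | succ t ih =>
          have h1 := le_boostedValue (hF i) (hpq i)
            (monotone_cutPoint hy.1 (Fin.castSucc_lt_succ (i := t)).le)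
          have h2 := hs t
          rw [cutPoint_succ y s, h0, add_zero] at h2
          have h3 := boostedValue_self (F := F i) (p := p i) (q := q i)
            (a := cutPoint y s.castSucc)
          linarith
      have := hle (Fin.last n)
      rw [cutPoint_last, cutPoint_zero, hy.2] at this
      exact absurd this (not_le.2 (hF01 i)))
  exact ⟨cutPoint y, monotone_cutPoint hy.1, cutPoint_zero y, by rw [cutPoint_last, hy.2], σ, hσ⟩

/-- The `s`-th of the consecutive half-open intervals into which `[0, 1]` is cut at `Y`. -/
def cutPiece (Y : Fin (n + 1) → ℝ) (s : Fin n) : Set ℝ :=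
  {x | x ∈ Icc (0 : ℝ) 1 ∧ Y s.castSucc ≤ x ∧ ∀ t : Fin n, s < t → x < Y t.castSucc}

/-- A point lies in the piece with the largest index whose left end does not exceed it. The last
piece has no later cut to respect, so it keeps the point `1`. -/
theorem isContiguousAllocation_cutPiece (hn : n ≠ 0) {Y : Fin (n + 1) → ℝ} (hY0 : Y 0 = 0)
    (σ : Equiv.Perm (Fin n)) : IsContiguousAllocation fun i => cutPiece Y (σ i) where
  ordConnected i := ⟨fun x hx y hy z hz => ⟨⟨hx.1.1.trans hz.1, hz.2.trans hy.1.2⟩,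
    hx.2.1.trans hz.1, fun t ht => hz.2.trans_lt (hy.2.2 t ht)⟩⟩
  disjoint i j hij := by
    rw [Set.disjoint_left]
    intro x hi hj
    rcases lt_or_gt_of_ne (σ.injective.ne hij) with h | h
    · exact absurd (hi.2.2 _ h) (not_lt.2 hj.2.1)
    · exact absurd (hj.2.2 _ h) (not_lt.2 hi.2.1)
  iUnion_eq := by
    classical
    ext x
    rw [mem_iUnion]
    refine ⟨fun ⟨i, hi⟩ => hi.1, fun hx => ?_⟩
    obtain ⟨m, rfl⟩ := Nat.exists_eq_succ_of_ne_zero hn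
    have hne : (Finset.univ.filter fun s : Fin (m + 1) => Y s.castSucc ≤ x).Nonempty :=
      ⟨0, by simpa [hY0] using hx.1⟩
    obtain ⟨s, hs, hmax⟩ := Finset.exists_max_image _ id hne
    refine ⟨σ.symm s, ?_⟩
    simp only [Equiv.apply_symm_apply]
    refine ⟨hx, (Finset.mem_filter.1 hs).2, fun t ht => ?_⟩
    by_contra hxt
    exact absurd (hmax t (Finset.mem_filter.2 ⟨Finset.mem_univ _, not_lt.1 hxt⟩)) (not_le.2 ht)

theorem cutPiece_ae_eq {Y : Fin (n + 1) → ℝ} (hY : Monotone Y) (hY0 : Y 0 = 0)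
    (hY1 : Y (Fin.last n) = 1) (s : Fin n) :
    cutPiece Y s =ᵐ[volume] Icc (Y s.castSucc) (Y s.succ) := by
  have h1 : cutPiece Y s ⊆ Icc (Y s.castSucc) (Y s.succ) := by
    intro x hx
    refine ⟨hx.2.1, ?_⟩
    by_cases hlast : s.succ = Fin.last n
    · rw [hlast, hY1]
      exact hx.1.2
    · obtain ⟨t, ht⟩ := Fin.exists_castSucc_eq.2 hlast
      rw [← ht]
      refine (hx.2.2 t ?_).le
      rw [← Fin.castSucc_lt_castSucc_iff, ht]
      exact Fin.castSucc_lt_succ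
  have h2 : Ioo (Y s.castSucc) (Y s.succ) ⊆ cutPiece Y s := by
    intro x hx
    refine ⟨⟨?_, ?_⟩, hx.1.le, fun t ht => hx.2.trans_le (hY ?_)⟩
    · rw [← hY0]
      exact (hY (Fin.zero_le _)).trans hx.1.le
    · rw [← hY1]
      exact hx.2.le.trans (hY (Fin.le_last _))
    · rwa [Fin.succ_le_castSucc_iff]
  exact h1.eventuallyLE.antisymm (Ioo_ae_eq_Icc.symm.le.trans h2.eventuallyLE)

end Cuts

/-! ### Distribution functions of the players -/

namespace CakeInstance

variable {n : ℕ} (I : CakeInstance n)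

/-- The value that player `i` assigns to `[0, x]`, extended by constants outside the cake. -/
noncomputable def cumulative (i : Fin n) (x : ℝ) : ℝ :=
  ∫ t in (0 : ℝ)..(projIcc (0 : ℝ) 1 zero_le_one x), I.density i t

theorem intervalIntegrable_density (i : Fin n) {a b : ℝ} (ha : a ∈ Icc (0 : ℝ) 1)
    (hb : b ∈ Icc (0 : ℝ) 1) : IntervalIntegrable (I.density i) volume a b :=
  ((I.continuousOn_density i).mono (uIcc_subset_Icc ha hb)).intervalIntegrable

theorem value_Icc (i : Fin n) {a b : ℝ} (ha : 0 ≤ a) (hab : a ≤ b) (hb : b ≤ 1) :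
    I.value i (Icc a b) = I.cumulative i b - I.cumulative i a := by
  have ha' : a ∈ Icc (0 : ℝ) 1 := ⟨ha, hab.trans hb⟩
  have hb' : b ∈ Icc (0 : ℝ) 1 := ⟨ha.trans hab, hb⟩
  rw [value, cumulative, cumulative, projIcc_of_mem _ ha', projIcc_of_mem _ hb',
    intervalIntegral.integral_interval_sub_left
      (I.intervalIntegrable_density i ⟨le_rfl, zero_le_one⟩ hb')
      (I.intervalIntegrable_density i ⟨le_rfl, zero_le_one⟩ ha'),
    intervalIntegral.integral_of_le hab, integral_Icc_eq_integral_Ioc]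

theorem continuous_cumulative (i : Fin n) : Continuous (I.cumulative i) := by
  have h : ContinuousOn (fun x => ∫ t in (0 : ℝ)..x, I.density i t) (Icc 0 1) := by
    have := intervalIntegral.continuousOn_primitive_interval (μ := volume) (f := I.density i)
      (a := 0) (b := 1)
      (by rw [uIcc_of_le zero_le_one]
          exact (I.continuousOn_density i).integrableOn_compact isCompact_Icc)
    rwa [uIcc_of_le zero_le_one] at this
  exact h.comp_continuous (continuous_subtype_val.comp continuous_projIcc) fun x => Subtype.prop _

theorem monotone_cumulative (i : Fin n) : Monotone (I.cumulative i) := by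
  intro a b hab
  have h := monotone_projIcc (zero_le_one (α := ℝ)) hab
  set a' := projIcc (0 : ℝ) 1 zero_le_one a with ha
  set b' := projIcc (0 : ℝ) 1 zero_le_one b with hb
  have h' : (a' : ℝ) ≤ b' := h
  have h0 : (0 : ℝ) ∈ Icc (0 : ℝ) 1 := ⟨le_rfl, zero_le_one⟩
  rw [cumulative, cumulative, ← ha, ← hb, ← sub_nonneg, intervalIntegral.integral_interval_sub_left
    (I.intervalIntegrable_density i h0 b'.2) (I.intervalIntegrable_density i h0 a'.2)]
  exact intervalIntegral.integral_nonneg h' fun x hx =>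
    I.density_nonneg i x ⟨a'.2.1.trans hx.1, hx.2.trans b'.2.2⟩

theorem cumulative_zero_lt_one (i : Fin n) : I.cumulative i 0 < I.cumulative i 1 := by
  have h := I.value_Icc i le_rfl zero_le_one le_rfl
  rw [value, I.integral_density] at h
  linarith

end CakeInstance

/-! ### Assembly -/

theorem lemma3p17 {n k : ℕ} (I : CakeInstance n) (P : I.OwnedPieces k) :
    ∃ A : Fin n → Set ℝ, IsContiguousAllocation A ∧ I.EnvyFree A ∧
      ∀ i, P.maxPieceValue i ≤ I.value i (A i) := by
  -- With no pieces the first and last boundary points would coincide, giving `0 = 1`.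
  have hnk : n * k ≠ 0 := by
    intro h
    have h1 : (0 : Fin (n * k + 1)) = Fin.last (n * k) := Fin.ext (by simp [h])
    have h2 := P.bdry_last
    rw [← h1, P.bdry_zero] at h2
    exact zero_ne_one h2
  have hn : n ≠ 0 := left_ne_zero_of_mul hnk
  have : Nonempty (Fin k) := Fin.pos_iff_nonempty.1 (Nat.pos_of_ne_zero (right_ne_zero_of_mul hnk))
  -- The index `b i` attains the maximum, so one piece per player suffices from here on.
  choose b hb using fun i => exists_eq_ciSup_of_finite (f := fun m : Fin k => I.value i (P.piece i m))
  set p : Fin n → ℝ := fun i => P.bdry (P.pos (i, b i)).castSucc with hpdef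
  set q : Fin n → ℝ := fun i => P.bdry (P.pos (i, b i)).succ with hqdef
  have hpq : ∀ i, p i ≤ q i := fun i => P.strictMono_bdry.monotone (Fin.castSucc_lt_succ).le
  have hp : ∀ i, 0 ≤ p i := fun i => by
    rw [← P.bdry_zero]
    exact P.strictMono_bdry.monotone (Fin.zero_le _)
  have hq : ∀ i, q i ≤ 1 := fun i => by
    rw [← P.bdry_last]
    exact P.strictMono_bdry.monotone (Fin.le_last _)
  have hsep : ∀ i l, i ≠ l → q i ≤ p l ∨ q l ≤ p i := by
    intro i l hil
    have hne : P.pos (i, b i) ≠ P.pos (l, b l) := fun h =>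
      hil (congrArg Prod.fst (P.pos.injective h))
    rcases lt_or_gt_of_ne hne with h | h
    · exact Or.inl (P.strictMono_bdry.monotone (Fin.succ_le_castSucc_iff.2 h))
    · exact Or.inr (P.strictMono_bdry.monotone (Fin.succ_le_castSucc_iff.2 h))
  have hzero : ∀ i l, l ≠ i → I.cumulative l (p i) = I.cumulative l (q i) := by
    intro i l hl
    have h := P.value_eq_zero i (b i) l hl
    rw [I.value_Icc l (hp i) (hpq i) (hq i)] at h
    exact (sub_eq_zero.1 h).symm
  obtain ⟨X, hX, hX0, hX1, σ, hσ⟩ := exists_envyFree_cuts_boosted hn I.monotone_cumulative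
    I.continuous_cumulative I.cumulative_zero_lt_one hpq
  obtain ⟨Y, hY, hY0, hY1, hef, hmax⟩ := exists_rounded_cuts I.monotone_cumulative
    I.cumulative_zero_lt_one hpq hp hq hsep hzero hX hX0 hX1 hσ
  have hval : ∀ i s, I.value i (cutPiece Y s) =
      I.cumulative i (Y s.succ) - I.cumulative i (Y s.castSucc) := by
    intro i s
    rw [← I.value_Icc i (hY0 ▸ hY (Fin.zero_le _)) (hY (Fin.castSucc_lt_succ).le)
      (hY1 ▸ hY (Fin.le_last _))]
    exact setIntegral_congr_set (cutPiece_ae_eq hY hY0 hY1 s)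
  refine ⟨fun i => cutPiece Y (σ i), isContiguousAllocation_cutPiece hn hY0 σ, fun i j => ?_,
    fun i => ?_⟩
  · rw [hval, hval]
    exact hef i (σ j)
  · rw [hval, CakeInstance.OwnedPieces.maxPieceValue, ← hb i]
    refine le_trans (le_of_eq ?_) (hmax i)
    exact I.value_Icc i (hp i) (hpq i) (hq i)
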